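/- Let $\Gamma$ be a countably infinite connected simple graph with symmetric edge weights $\mu_{x,y}=\mu_{y,x}$, where $\mu_{x,y}>0$ if $x\sim y$ and $\mu_{x,y}=0$ otherwise, such that $\mu(x)=\sum_{y\sim x}\mu_{x,y}<\infty$ for every vertex $x$. Put $\mu(A)=\sum_{y\in A}\mu(y)$ for $A\subset\Gamma$, $P(x,y)=\mu_{x,y}/\mu(x)$, $Pf(x)=\sum_yP(x,y)f(y)$, $\Delta=P-I$ and $(f,g)_\mu=\sum_x f(x)g(x)\mu(x)$. Let $d$ be the graph distance and, for real $R>0$, let $B(x,R)=\{y:d(x,y)<R\}$ and $V(x,R)=\mu(B(x,R))$. For $0<r<R$ let $v(x,r,R)=V(x,R)-V(x,r)$ and $\rho(x,r,R)=\rho(B(x,r),\Gamma\setminus B(x,R))$, where for disjoint $A,B\subset\Gamma$ $$\rho(A,B)=\Bigl(\inf\bigl\{(-\Delta f,f)_\mu : f \text{ finitely supported},\ f|_A=1,\ f|_B=0\bigr\}\Bigr)^{-1}.$$ Suppose that the following four conditions hold. - $(p_0)$: there is $p_0>0$ such that $\mu_{x,y}/\mu(x)\ge p_0$ for all $x\sim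 y$. - $(VD)$: there is $D_V>0$ such that $V(x,2R)\le D_V V(x,R)$ for all $x\in\Gamma$ and $R>0$. - $(H)$: there is $H>1$ such that for all $x\in\Gamma$, $R>0$ and every function $u\ge 0$ that is defined on $B(x,2R)$ and the neighbours of its vertices and satisfies $Pu=u$ on $B(x,2R)$, one has $\max_{B(x,R)}u\le H\min_{B(x,R)}u$. - $(\rho v)$: there is $C>1$ such that $C^{-1}\rho(x,R,2R)v(x,R,2R)\le\rho(y,R,2R)v(y,R,2R)\le C\rho(x,R,2R)v(x,R,2R)$ for all $x,y\in\Gamma$ and $R>0$. Then there is $A>1$ such that for all $x\in\Gamma$ and all $R>0$ $$\rho(x,AR,2AR)\,v(x,AR,2AR)\ \ge\ 2\,\rho(x,R,2R)\,v(x,R,2R).$$ -/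

import Mathlib

/-- A weighted graph on the vertex set `V`: a simple graph together with a symmetric weight
`μ_{x,y}` which is positive exactly on the edges, and whose sum around each vertex is finite. -/
structure WeightedGraph (V : Type*) where
  graph : SimpleGraph V
  weight : V → V → ℝ
  weight_symm : ∀ x y, weight x y = weight y x
  weight_pos : ∀ x y, graph.Adj x y → 0 < weight x y
  weight_eq_zero : ∀ x y, ¬ graph.Adj x y → weight x y = 0
  weight_summable : ∀ x, Summable (fun y => weight x y)

namespace WeightedGraph

noncomputable section

variable {V : Type*} (Γ : WeightedGraph V)

/-- `μ(x) = ∑_{y ∼ x} μ_{x,y}`. -/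
def vertexMeasure (x : V) : ℝ := ∑' y, Γ.weight x y

/-- `μ(A) = ∑_{y ∈ A} μ(y)`. -/
def setMeasure (A : Set V) : ℝ := ∑' y : A, Γ.vertexMeasure y

/-- Transition probability `P(x,y) = μ_{x,y} / μ(x)`. -/
def transition (x y : V) : ℝ := Γ.weight x y / Γ.vertexMeasure x

/-- Markov operator `P f(x) = ∑_y P(x,y) f(y)`. -/
def markov (f : V → ℝ) (x : V) : ℝ := ∑' y, Γ.transition x y * f y

/-- Laplace operator `Δ = P - I`. -/
def laplacian (f : V → ℝ) (x : V) : ℝ := Γ.markov f x - f x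

/-- `(f,g)_μ = ∑_x f(x) g(x) μ(x)`, used when one of the functions is finitely supported. -/
def innerMu (f g : V → ℝ) : ℝ := ∑' x, f x * g x * Γ.vertexMeasure x

/-- Open ball `B(x,R) = {y : d(x,y) < R}` for the graph distance. -/
def ball (x : V) (R : ℝ) : Set V := {y | (Γ.graph.dist x y : ℝ) < R}

/-- `V(x,R) = μ(B(x,R))`. -/
def volume (x : V) (R : ℝ) : ℝ := Γ.setMeasure (Γ.ball x R)

/-- Volume of the annulus, `v(x,r,R) = V(x,R) - V(x,r)`. -/
def annulusVolume (x : V) (r R : ℝ) : ℝ := Γ.volume x R - Γ.volume x r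

/-- Resistance between `A` and `B`: the inverse of the infimum of the Dirichlet form `(-Δf, f)_μ`
over the finitely supported `f` with `f = 1` on `A` and `f = 0` on `B`. -/
def resistance (A B : Set V) : ℝ :=
  (sInf {e : ℝ | ∃ f : V → ℝ, f.support.Finite ∧ (∀ x ∈ A, f x = 1) ∧ (∀ x ∈ B, f x = 0) ∧
    e = Γ.innerMu (fun x => - Γ.laplacian f x) f})⁻¹

/-- Resistance of the annulus, `ρ(x,r,R) = ρ(B(x,r), Γ \ B(x,R))`. -/
def annulusResistance (x : V) (r R : ℝ) : ℝ := Γ.resistance (Γ.ball x r) (Γ.ball x R)ᶜ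

/-- The product `ρ(x,R,2R) v(x,R,2R)`. -/
def rhoV (x : V) (R : ℝ) : ℝ :=
  Γ.annulusResistance x R (2 * R) * Γ.annulusVolume x R (2 * R)

/-- Condition `(p₀)`. -/
def CondP0 : Prop :=
  ∃ p₀ : ℝ, 0 < p₀ ∧ ∀ x y, Γ.graph.Adj x y → p₀ ≤ Γ.weight x y / Γ.vertexMeasure x

/-- Volume doubling `(VD)`. -/
def VolumeDoubling : Prop :=
  ∃ D : ℝ, 0 < D ∧ ∀ (x : V) (R : ℝ), 0 < R → Γ.volume x (2 * R) ≤ D * Γ.volume x R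

/-- The closure of `A`: the vertices of `A` and their neighbours. -/
def closure (A : Set V) : Set V := A ∪ {y | ∃ x ∈ A, Γ.graph.Adj x y}

/-- `h` is harmonic on `A`: `P h = h` on `A`. Only the values of `h` on the closure of `A`
matter. -/
def IsHarmonicOn (h : V → ℝ) (A : Set V) : Prop := ∀ x ∈ A, Γ.markov h x = h x

/-- The elliptic Harnack inequality `(H)`: `max_{B(x,R)} u ≤ H min_{B(x,R)} u` for every
nonnegative `u` harmonic in `B(x,2R)`. -/
def EllipticHarnack : Prop :=
  ∃ H : ℝ, 1 < H ∧ ∀ (x : V) (R : ℝ), 0 < R → ∀ u : V → ℝ,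
    (∀ y ∈ Γ.closure (Γ.ball x (2 * R)), 0 ≤ u y) →
    Γ.IsHarmonicOn u (Γ.ball x (2 * R)) →
    ∀ y ∈ Γ.ball x R, ∀ z ∈ Γ.ball x R, u y ≤ H * u z

/-- Condition `(ρv)`: `ρ(x,R,2R) v(x,R,2R) ≃ ρ(y,R,2R) v(y,R,2R)`, uniformly in `x`, `y`, `R`. -/
def CondRhoV : Prop :=
  ∃ C : ℝ, 1 < C ∧ ∀ (x y : V) (R : ℝ), 0 < R →
    C⁻¹ * Γ.rhoV x R ≤ Γ.rhoV y R ∧ Γ.rhoV y R ≤ C * Γ.rhoV x R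

end

end WeightedGraph

namespace WeightedGraph

noncomputable section

variable {V : Type*} (Γ : WeightedGraph V)

/-! A lower bound on a resistance needs only one test function of small energy. Let `F = ρv(x,R) >
0`. By `(ρv)`, every ball `B(y,R)` has a cutoff inside `B(y,2R)` of energy at most about `(C/F)
v(y,R,2R)`. Gluing these by maxima over an `R`-net of `B(x,r)` gives a cutoff across a shell of
width `2R`; the balls `B(y,R/2)` are disjoint, so doubling bounds its energy by `2CD²/F` times the
volume of the enclosing ball (`hasCutoff_ball`).

With `T = 4kR`, the annulus between `T` and `2T` holds `k` separated shells. Averaging their cutoffs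
divides the energy by `k`, since no edge sees two of them vary (`hasCutoff_average`). As `v(x,T,2T)
≥ D⁻⁴ V(x,2T)` (`volume_le_annulusVolume`), the volume cancels: `ρv(x,T) ≥ kF/(2CD⁶)`, and it
remains to take `k` large. -/

lemma weight_nonneg (x y : V) : 0 ≤ Γ.weight x y := by
  by_cases h : Γ.graph.Adj x y
  · exact (Γ.weight_pos x y h).le
  · exact (Γ.weight_eq_zero x y h).ge

lemma vertexMeasure_nonneg (x : V) : 0 ≤ Γ.vertexMeasure x :=
  tsum_nonneg fun y => Γ.weight_nonneg x y

lemma vertexMeasure_pos {x y : V} (h : Γ.graph.Adj x y) : 0 < Γ.vertexMeasure x :=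
  (Γ.weight_summable x).tsum_pos (Γ.weight_nonneg x) y (Γ.weight_pos x y h)

/-! ### Local finiteness and the graph metric -/

variable {Γ}

/-- Summable weights around `x` tend to zero, whereas `(p₀)` keeps those on edges above `p μ(x)`. -/
lemma CondP0.finite_neighbors (hp : Γ.CondP0) (x : V) : {y | Γ.graph.Adj x y}.Finite := by
  obtain ⟨p, hp, hpw⟩ := hp
  by_cases hx : ∃ y, Γ.graph.Adj x y
  · obtain ⟨z, hz⟩ := hx
    have hμ := Γ.vertexMeasure_pos hz
    have ht := (Γ.weight_summable x).tendsto_cofinite_zero.eventually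
      (gt_mem_nhds (mul_pos hp hμ))
    refine (Filter.eventually_cofinite.1 ht).subset fun y hy => ?_
    exact not_lt.2 ((le_div_iff₀ hμ).1 (hpw x y hy))
  · push Not at hx
    convert Set.finite_empty
    ext y
    simpa using hx y

lemma exists_adj_of_dist_eq_succ (hconn : Γ.graph.Connected) {x z : V} {n : ℕ}
    (h : Γ.graph.dist x z = n + 1) : ∃ y, Γ.graph.dist x y = n ∧ Γ.graph.Adj y z := by
  -- The geodesic starts at `z`, so that its first edge gives the neighbour.
  obtain ⟨p, hp⟩ := hconn.exists_walk_length_eq_dist z x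
  rw [SimpleGraph.dist_comm, h] at hp
  cases p with
  | nil => simp at hp
  | @cons _ y _ hadj q =>
    refine ⟨y, ?_, hadj.symm⟩
    have h1 : Γ.graph.dist y x ≤ q.length := SimpleGraph.dist_le q
    have h2 : Γ.graph.dist x z ≤ Γ.graph.dist x y + Γ.graph.dist y z := hconn.dist_triangle
    have h3 : Γ.graph.dist y z = 1 := SimpleGraph.dist_eq_one_iff_adj.2 hadj.symm
    rw [SimpleGraph.dist_comm] at h1
    simp only [SimpleGraph.Walk.length_cons] at hp
    omega

lemma finite_dist_le (hconn : Γ.graph.Connected) (hp : Γ.CondP0) (x : V) (n : ℕ) :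
    {y | Γ.graph.dist x y ≤ n}.Finite := by
  induction n with
  | zero =>
    refine (Set.finite_singleton x).subset fun y hy => ?_
    have : Γ.graph.dist x y = 0 := Nat.le_zero.1 hy
    exact (hconn.dist_eq_zero_iff.1 this).symm
  | succ n ih =>
    refine (ih.union (ih.biUnion fun z _ => hp.finite_neighbors z)).subset fun y hy => ?_
    rcases Nat.lt_or_eq_of_le (show Γ.graph.dist x y ≤ n + 1 from hy) with h | h
    · exact Or.inl (Nat.lt_succ_iff.1 h)
    · obtain ⟨z, hz, hzy⟩ := exists_adj_of_dist_eq_succ hconn h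
      exact Or.inr (Set.mem_biUnion (show z ∈ {y | Γ.graph.dist x y ≤ n} from hz.le) hzy)

lemma finite_ball (hconn : Γ.graph.Connected) (hp : Γ.CondP0) (x : V) (R : ℝ) :
    (Γ.ball x R).Finite :=
  (finite_dist_le hconn hp x ⌈R⌉₊).subset fun y hy => by
    have : (Γ.graph.dist x y : ℝ) < ⌈R⌉₊ := lt_of_lt_of_le hy (Nat.le_ceil R)
    exact le_of_lt (by exact_mod_cast this)

lemma finite_closure (hp : Γ.CondP0) {U : Set V} (hU : U.Finite) : (Γ.closure U).Finite := by
  refine (hU.union (hU.biUnion fun z _ => hp.finite_neighbors z)).subset ?_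
  rintro y (hy | ⟨z, hz, hzy⟩)
  · exact Or.inl hy
  · exact Or.inr (Set.mem_biUnion hz hzy)

lemma exists_dist_eq [Infinite V] (hconn : Γ.graph.Connected) (hp : Γ.CondP0) (x : V) (n : ℕ) :
    ∃ z, Γ.graph.dist x z = n := by
  obtain ⟨z, hz⟩ := (finite_dist_le hconn hp x n).exists_notMem
  have key : ∀ m, ∀ z, Γ.graph.dist x z = n + m → ∃ z, Γ.graph.dist x z = n := by
    intro m
    induction m with
    | zero => exact fun z hz => ⟨z, hz⟩
    | succ m ih =>
      intro z hz
      obtain ⟨y, hy, -⟩ := exists_adj_of_dist_eq_succ hconn (n := n + m) hz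
      exact ih y hy
  have hz' : ¬ Γ.graph.dist x z ≤ n := hz
  exact key (Γ.graph.dist x z - n) z (by omega)

lemma dist_triangle_real (hconn : Γ.graph.Connected) (x y z : V) :
    (Γ.graph.dist x z : ℝ) ≤ Γ.graph.dist x y + Γ.graph.dist y z := by
  exact_mod_cast hconn.dist_triangle

lemma mem_ball_self (x : V) {R : ℝ} (hR : 0 < R) : x ∈ Γ.ball x R := by
  simpa [ball] using hR

lemma ball_mono (x : V) {r R : ℝ} (h : r ≤ R) : Γ.ball x r ⊆ Γ.ball x R :=
  fun _ hy => lt_of_lt_of_le hy h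

lemma ball_subset_ball (hconn : Γ.graph.Connected) {x y : V} {r R : ℝ}
    (h : Γ.graph.dist x y + r ≤ R) : Γ.ball y r ⊆ Γ.ball x R := fun z hz => by
  have h1 := dist_triangle_real hconn x y z
  have h2 : (Γ.graph.dist y z : ℝ) < r := hz
  show (Γ.graph.dist x z : ℝ) < R
  linarith

lemma disjoint_ball (hconn : Γ.graph.Connected) {x y : V} {r s : ℝ}
    (h : r + s ≤ Γ.graph.dist x y) : Disjoint (Γ.ball x r) (Γ.ball y s) := by
  rw [Set.disjoint_left]
  intro z hx hy
  have h1 := dist_triangle_real hconn x z y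
  have h2 : (Γ.graph.dist x z : ℝ) < r := hx
  have h3 : (Γ.graph.dist y z : ℝ) < s := hy
  rw [SimpleGraph.dist_comm] at h3
  linarith

lemma ball_eq_singleton (hconn : Γ.graph.Connected) (x : V) {R : ℝ} (h0 : 0 < R) (h1 : R ≤ 1) :
    Γ.ball x R = {x} := by
  ext y
  refine ⟨fun hy => ?_, fun hy => ?_⟩
  · have h2 : (Γ.graph.dist x y : ℝ) < 1 := lt_of_lt_of_le hy h1
    have h3 : Γ.graph.dist x y = 0 := by
      have : Γ.graph.dist x y < 1 := by exact_mod_cast h2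
      omega
    exact (hconn.dist_eq_zero_iff.1 h3).symm
  · rw [Set.mem_singleton_iff.1 hy]
    exact mem_ball_self x h0

/-! ### Volumes -/

lemma setMeasure_coe (s : Finset V) : Γ.setMeasure s = ∑ x ∈ s, Γ.vertexMeasure x :=
  Finset.tsum_subtype s Γ.vertexMeasure

lemma setMeasure_nonneg (A : Set V) : 0 ≤ Γ.setMeasure A :=
  tsum_nonneg fun y => Γ.vertexMeasure_nonneg y

lemma setMeasure_mono {A B : Set V} (hB : B.Finite) (h : A ⊆ B) :
    Γ.setMeasure A ≤ Γ.setMeasure B := by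
  lift B to Finset V using hB
  lift A to Finset V using B.finite_toSet.subset h
  rw [setMeasure_coe, setMeasure_coe]
  exact Finset.sum_le_sum_of_subset_of_nonneg (by exact_mod_cast h)
    fun y _ _ => Γ.vertexMeasure_nonneg y

lemma setMeasure_union {A B : Set V} (hA : A.Finite) (hB : B.Finite) (h : Disjoint A B) :
    Γ.setMeasure (A ∪ B) = Γ.setMeasure A + Γ.setMeasure B := by
  classical
  lift A to Finset V using hA
  lift B to Finset V using hB
  rw [← Finset.coe_union, setMeasure_coe, setMeasure_coe, setMeasure_coe,
    Finset.sum_union (by exact_mod_cast h)]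

lemma sum_setMeasure_le {ι : Type*} (Y : Finset ι) (A : ι → Set V) {B : Set V} (hB : B.Finite)
    (hA : ∀ i ∈ Y, A i ⊆ B) (hd : ∀ i ∈ Y, ∀ j ∈ Y, i ≠ j → Disjoint (A i) (A j)) :
    ∑ i ∈ Y, Γ.setMeasure (A i) ≤ Γ.setMeasure B := by
  classical
  have key : ∑ i ∈ Y, Γ.setMeasure (A i) = Γ.setMeasure (⋃ i ∈ Y, A i) := by
    induction Y using Finset.induction_on with
    | empty => simp [setMeasure]
    | insert i Y hi ih =>
      rw [Finset.sum_insert hi, ih (fun j hj => hA j (Finset.mem_insert_of_mem hj))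
        (fun j hj k hk => hd j (Finset.mem_insert_of_mem hj) k (Finset.mem_insert_of_mem hk)),
        Finset.set_biUnion_insert, setMeasure_union]
      · exact hB.subset (hA i (Finset.mem_insert_self i Y))
      · exact hB.subset (Set.iUnion₂_subset fun j hj => hA j (Finset.mem_insert_of_mem hj))
      · refine Set.disjoint_iUnion₂_right.2 fun j hj => ?_
        exact hd i (Finset.mem_insert_self i Y) j (Finset.mem_insert_of_mem hj)
          (fun h => hi (h ▸ hj))
  rw [key]
  exact setMeasure_mono hB (Set.iUnion₂_subset hA)

lemma volume_mono (hconn : Γ.graph.Connected) (hp : Γ.CondP0) (x : V) {r R : ℝ} (h : r ≤ R) :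
    Γ.volume x r ≤ Γ.volume x R :=
  setMeasure_mono (finite_ball hconn hp x R) (ball_mono x h)

lemma annulusVolume_nonneg (hconn : Γ.graph.Connected) (hp : Γ.CondP0) (x : V) {r R : ℝ}
    (h : r ≤ R) : 0 ≤ Γ.annulusVolume x r R :=
  sub_nonneg.2 (volume_mono hconn hp x h)

/-- A ball `B(z,T/4)` with `d(x,z)` about `3T/2` fits in the annulus, and four doublings of it cover
`B(x,2T)`. Rounding the distance costs less than `1`, which `4 ≤ T` absorbs. -/
lemma volume_le_annulusVolume [Infinite V] (hconn : Γ.graph.Connected) (hp : Γ.CondP0) {D : ℝ}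
    (hD : 0 < D) (hVD : ∀ (x : V) (R : ℝ), 0 < R → Γ.volume x (2 * R) ≤ D * Γ.volume x R)
    (x : V) {T : ℝ} (hT : 4 ≤ T) :
    Γ.volume x (2 * T) ≤ D ^ 4 * Γ.annulusVolume x T (2 * T) := by
  obtain ⟨z, hz⟩ := exists_dist_eq hconn hp x ⌈3 * T / 2⌉₊
  have hz1 : 3 * T / 2 ≤ Γ.graph.dist x z := by rw [hz]; exact Nat.le_ceil _
  have hz2 : (Γ.graph.dist x z : ℝ) < 3 * T / 2 + 1 := by
    rw [hz]; exact Nat.ceil_lt_add_one (by linarith)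
  have h1 : Γ.volume x (2 * T) ≤ Γ.volume z (4 * T) := by
    refine setMeasure_mono (finite_ball hconn hp _ _) (ball_subset_ball hconn ?_)
    rw [SimpleGraph.dist_comm]
    linarith
  have h2 : Γ.volume z (4 * T) ≤ D ^ 4 * Γ.volume z (T / 4) := by
    have a1 := hVD z (T / 4) (by linarith)
    have a2 := hVD z (T / 2) (by linarith)
    have a3 := hVD z T (by linarith)
    have a4 := hVD z (2 * T) (by linarith)
    rw [show 2 * (T / 4) = T / 2 by ring] at a1
    rw [show 2 * (T / 2) = T by ring] at a2
    rw [show 2 * (2 * T) = 4 * T by ring] at a4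
    calc Γ.volume z (4 * T) ≤ D * (D * (D * (D * Γ.volume z (T / 4)))) := by
          refine a4.trans (mul_le_mul_of_nonneg_left (a3.trans (mul_le_mul_of_nonneg_left
            (a2.trans (mul_le_mul_of_nonneg_left a1 hD.le)) hD.le)) hD.le)
      _ = _ := by ring
  have h3 : Γ.volume x T + Γ.volume z (T / 4) ≤ Γ.volume x (2 * T) := by
    unfold volume
    rw [← setMeasure_union (finite_ball hconn hp _ _) (finite_ball hconn hp _ _)
      (disjoint_ball hconn (by linarith))]
    refine setMeasure_mono (finite_ball hconn hp _ _) (Set.union_subset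
      (ball_mono x (by linarith)) (ball_subset_ball hconn (by linarith)))
  refine h1.trans (h2.trans (mul_le_mul_of_nonneg_left ?_ (by positivity)))
  unfold annulusVolume
  linarith

/-! ### The Dirichlet form -/

variable (Γ) in
/-- The Dirichlet energy of `f` over the edges with both ends in the finite set `S`. -/
def energy (S : Finset V) (f : V → ℝ) : ℝ :=
  (∑ x ∈ S, ∑ y ∈ S, Γ.weight x y * (f x - f y) ^ 2) / 2

lemma weight_mul_sq_nonneg (f : V → ℝ) (x y : V) : 0 ≤ Γ.weight x y * (f x - f y) ^ 2 :=
  mul_nonneg (Γ.weight_nonneg x y) (sq_nonneg _)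

lemma energy_nonneg (S : Finset V) (f : V → ℝ) : 0 ≤ Γ.energy S f :=
  div_nonneg (Finset.sum_nonneg fun x _ => Finset.sum_nonneg fun y _ =>
    weight_mul_sq_nonneg f x y) zero_le_two

/-- Discrete Green formula. Since `S` contains the closure of `U`, no edge on which `f` varies is
lost, and the energy over `S` is the full Dirichlet form. -/
lemma innerMu_eq_energy {U : Set V} {S : Finset V} (hS : Γ.closure U ⊆ S) {f : V → ℝ}
    (hf : ∀ x ∉ U, f x = 0) :
    Γ.innerMu (fun x => - Γ.laplacian f x) f = Γ.energy S f := by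
  have hf' : ∀ x ∉ S, f x = 0 := fun x hx => hf x fun h => hx (hS (Or.inl h))
  have h1 : Γ.innerMu (fun x => - Γ.laplacian f x) f =
      ∑ x ∈ S, ∑ y ∈ S, Γ.weight x y * ((f x - f y) * f x) := by
    unfold innerMu
    rw [tsum_eq_sum (s := S) fun x hx => by rw [hf' x hx]; ring]
    refine Finset.sum_congr rfl fun x _ => ?_
    by_cases hx : f x = 0
    · simp [hx]
    have hxU : x ∈ U := by by_contra h; exact hx (hf x h)
    have hw : ∀ y ∉ S, Γ.weight x y = 0 := fun y hy =>
      Γ.weight_eq_zero x y fun h => hy (hS (Or.inr ⟨x, hxU, h⟩))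
    have hμ : Γ.vertexMeasure x = ∑ y ∈ S, Γ.weight x y := tsum_eq_sum hw
    have hM : Γ.markov f x * Γ.vertexMeasure x = ∑ y ∈ S, Γ.weight x y * f y := by
      unfold markov
      rw [tsum_eq_sum (s := S) fun y hy => by rw [hf' y hy, mul_zero], Finset.sum_mul]
      refine Finset.sum_congr rfl fun y _ => ?_
      unfold transition
      by_cases h : Γ.graph.Adj x y
      · have := (Γ.vertexMeasure_pos h).ne'
        field_simp
      · simp [Γ.weight_eq_zero x y h]
    calc -(Γ.laplacian f x) * f x * Γ.vertexMeasure x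
        = f x * (f x * Γ.vertexMeasure x - Γ.markov f x * Γ.vertexMeasure x) := by
          unfold laplacian; ring
      _ = _ := by
          rw [hM, hμ, Finset.mul_sum, ← Finset.sum_sub_distrib, Finset.mul_sum]
          exact Finset.sum_congr rfl fun y _ => by ring
  have h2 : ∑ x ∈ S, ∑ y ∈ S, Γ.weight x y * ((f x - f y) * f x) =
      ∑ x ∈ S, ∑ y ∈ S, Γ.weight x y * ((f y - f x) * f y) := by
    rw [Finset.sum_comm]
    exact Finset.sum_congr rfl fun x _ => Finset.sum_congr rfl fun y _ => by
      rw [Γ.weight_symm]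
  have h3 : ∑ x ∈ S, ∑ y ∈ S, Γ.weight x y * (f x - f y) ^ 2 =
      ∑ x ∈ S, ∑ y ∈ S, Γ.weight x y * ((f x - f y) * f x) +
      ∑ x ∈ S, ∑ y ∈ S, Γ.weight x y * ((f y - f x) * f y) := by
    rw [← Finset.sum_add_distrib]
    refine Finset.sum_congr rfl fun x _ => ?_
    rw [← Finset.sum_add_distrib]
    exact Finset.sum_congr rfl fun y _ => by ring
  unfold energy
  rw [h3, ← h2, h1]
  ring

lemma weight_mul_sq_le_energy {U : Set V} {S : Finset V} (hS : Γ.closure U ⊆ S) {f : V → ℝ}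
    (hf : ∀ x ∉ U, f x = 0) {x y : V} (h : Γ.graph.Adj x y) :
    Γ.weight x y * (f x - f y) ^ 2 ≤ 2 * Γ.energy S f := by
  by_cases hxy : f x = f y
  · rw [hxy]
    simpa using energy_nonneg S f
  have hU : x ∈ U ∨ y ∈ U := by
    by_contra! hn
    exact hxy (by rw [hf x hn.1, hf y hn.2])
  have hm : x ∈ S ∧ y ∈ S := by
    rcases hU with hU | hU
    · exact ⟨hS (Or.inl hU), hS (Or.inr ⟨x, hU, h⟩)⟩
    · exact ⟨hS (Or.inr ⟨y, hU, h.symm⟩), hS (Or.inl hU)⟩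
  calc Γ.weight x y * (f x - f y) ^ 2 ≤ ∑ y ∈ S, Γ.weight x y * (f x - f y) ^ 2 :=
        Finset.single_le_sum (f := fun y => Γ.weight x y * (f x - f y) ^ 2)
          (fun y _ => weight_mul_sq_nonneg f x y) hm.2
    _ ≤ ∑ x ∈ S, ∑ y ∈ S, Γ.weight x y * (f x - f y) ^ 2 :=
        Finset.single_le_sum (f := fun x => ∑ y ∈ S, Γ.weight x y * (f x - f y) ^ 2)
          (fun x _ => Finset.sum_nonneg fun y _ => weight_mul_sq_nonneg f x y) hm.1
    _ = 2 * Γ.energy S f := by unfold energy; ring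

/-- `K` depends on the walk only. This uniformity is what later keeps the infimum defining the
resistance away from zero. -/
lemma exists_sq_sub_le_energy {x z : V} (p : Γ.graph.Walk x z) :
    ∃ K : ℝ, 0 < K ∧ ∀ (U : Set V) (S : Finset V) (f : V → ℝ), Γ.closure U ⊆ S →
      (∀ x ∉ U, f x = 0) → (f x - f z) ^ 2 ≤ K * Γ.energy S f := by
  induction p with
  | nil => exact ⟨1, one_pos, fun U S f _ _ => by simpa using energy_nonneg S f⟩
  | @cons x y z h q ih =>
    obtain ⟨K, hK, ih⟩ := ih
    have hw := Γ.weight_pos x y h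
    refine ⟨4 / Γ.weight x y + 2 * K, by positivity, fun U S f hS hf => ?_⟩
    have h1 : (f x - f y) ^ 2 ≤ 2 * Γ.energy S f / Γ.weight x y := by
      rw [le_div_iff₀ hw, mul_comm]
      exact weight_mul_sq_le_energy hS hf h
    have h2 := ih U S f hS hf
    calc (f x - f z) ^ 2 ≤ 2 * (f x - f y) ^ 2 + 2 * (f y - f z) ^ 2 := by
          nlinarith [sq_nonneg ((f x - f y) - (f y - f z))]
      _ ≤ 2 * (2 * Γ.energy S f / Γ.weight x y) + 2 * (K * Γ.energy S f) := by gcongr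
      _ = _ := by ring

/-! ### Cutoff functions -/

variable (Γ) in
/-- There is a function between `0` and `1`, equal to `1` on `A` and vanishing off `U`, whose
energy over `S` is at most `e`. -/
def HasCutoff (S : Finset V) (A U : Set V) (e : ℝ) : Prop :=
  ∃ g : V → ℝ, (∀ x, 0 ≤ g x ∧ g x ≤ 1) ∧ (∀ x ∈ A, g x = 1) ∧ (∀ x ∉ U, g x = 0) ∧
    Γ.energy S g ≤ e

lemma HasCutoff.mono {S : Finset V} {A A' U U' : Set V} {e e' : ℝ} (h : Γ.HasCutoff S A U e)
    (hA : A' ⊆ A) (hU : U ⊆ U') (he : e ≤ e') : Γ.HasCutoff S A' U' e' := by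
  obtain ⟨g, h1, h2, h3, h4⟩ := h
  exact ⟨g, h1, fun x hx => h2 x (hA hx), fun x hx => h3 x fun h => hx (hU h), h4.trans he⟩

/-- On each edge the increment of the maximum is at most the larger of the two increments, so its
square is at most the sum of their squares. -/
lemma energy_max_le (S : Finset V) (f g : V → ℝ) :
    Γ.energy S (fun x => max (f x) (g x)) ≤ Γ.energy S f + Γ.energy S g := by
  unfold energy
  rw [← add_div, ← Finset.sum_add_distrib]
  gcongr with x _
  rw [← Finset.sum_add_distrib]
  gcongr with y _
  rw [← mul_add]
  refine mul_le_mul_of_nonneg_left ?_ (Γ.weight_nonneg x y)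
  have h := abs_max_sub_max_le_max (f x) (g x) (f y) (g y)
  rw [← sq_abs, ← sq_abs (f x - f y), ← sq_abs (g x - g y)]
  rcases le_max_iff.1 h with h | h
  · have := pow_le_pow_left₀ (abs_nonneg _) h 2
    have := sq_nonneg |g x - g y|
    linarith
  · have := pow_le_pow_left₀ (abs_nonneg _) h 2
    have := sq_nonneg |f x - f y|
    linarith

lemma energy_clip_le (S : Finset V) (f : V → ℝ) :
    Γ.energy S (fun x => max 0 (min 1 (f x))) ≤ Γ.energy S f := by
  unfold energy
  refine div_le_div_of_nonneg_right (Finset.sum_le_sum fun x _ => Finset.sum_le_sum fun y _ =>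
    mul_le_mul_of_nonneg_left (sq_le_sq.2 ?_) (Γ.weight_nonneg x y)) zero_le_two
  refine (abs_max_sub_max_le_max _ _ _ _).trans (max_le (by simp) ?_)
  exact (abs_min_sub_min_le_max _ _ _ _).trans (max_le (by simp) le_rfl)

lemma HasCutoff.union {S : Finset V} {A A' U U' : Set V} {e e' : ℝ} (h : Γ.HasCutoff S A U e)
    (h' : Γ.HasCutoff S A' U' e') : Γ.HasCutoff S (A ∪ A') (U ∪ U') (e + e') := by
  obtain ⟨f, f1, f2, f3, f4⟩ := h
  obtain ⟨g, g1, g2, g3, g4⟩ := h'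
  refine ⟨fun x => max (f x) (g x), fun x => ⟨le_max_of_le_left (f1 x).1,
    max_le (f1 x).2 (g1 x).2⟩, ?_, fun x hx => ?_, (energy_max_le S f g).trans (add_le_add f4 g4)⟩
  · rintro x (hx | hx)
    · simpa [f2 x hx] using (g1 x).2
    · simpa [g2 x hx] using (f1 x).2
  · have h1 := f3 x fun h => hx (Or.inl h)
    have h2 := g3 x fun h => hx (Or.inr h)
    simp [h1, h2]

lemma HasCutoff.biUnion {ι : Type*} {S : Finset V} (Y : Finset ι) {A U : ι → Set V} {e : ι → ℝ}
    (h : ∀ i ∈ Y, Γ.HasCutoff S (A i) (U i) (e i)) :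
    Γ.HasCutoff S (⋃ i ∈ Y, A i) (⋃ i ∈ Y, U i) (∑ i ∈ Y, e i) := by
  classical
  induction Y using Finset.induction_on with
  | empty => exact ⟨fun _ => 0, by simp, by simp, by simp, by simp [energy]⟩
  | insert i Y hi ih =>
    rw [Finset.set_biUnion_insert, Finset.set_biUnion_insert, Finset.sum_insert hi]
    exact (h i (Finset.mem_insert_self i Y)).union
      (ih fun j hj => h j (Finset.mem_insert_of_mem hj))

/-- At most one `g i` varies on any edge, so all cross terms vanish when the square is expanded. -/
lemma energy_sum_div {S : Finset V} {g : ℕ → V → ℝ} (k : ℕ) (c : ℝ)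
    (hd : ∀ i j, i ≠ j → ∀ x y, Γ.graph.Adj x y → g i x ≠ g i y → g j x = g j y) :
    Γ.energy S (fun x => (∑ i ∈ Finset.range k, g i x) / c) =
      (∑ i ∈ Finset.range k, Γ.energy S (g i)) / c ^ 2 := by
  have hsq : ∀ x y, Γ.graph.Adj x y → (∑ i ∈ Finset.range k, (g i x - g i y)) ^ 2 =
      ∑ i ∈ Finset.range k, (g i x - g i y) ^ 2 := by
    intro x y hxy
    rw [sq, Finset.sum_mul_sum]
    refine Finset.sum_congr rfl fun i hi => ?_
    rw [Finset.sum_eq_single_of_mem i hi, sq]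
    intro j _ hji
    by_cases h : g i x = g i y
    · rw [h, sub_self, zero_mul]
    · rw [hd i j hji.symm x y hxy h, sub_self, mul_zero]
  have hcomm : ∑ i ∈ Finset.range k, ∑ x ∈ S, ∑ y ∈ S, Γ.weight x y * (g i x - g i y) ^ 2 =
      ∑ x ∈ S, ∑ y ∈ S, ∑ i ∈ Finset.range k, Γ.weight x y * (g i x - g i y) ^ 2 := by
    rw [Finset.sum_comm]
    exact Finset.sum_congr rfl fun x _ => Finset.sum_comm
  unfold energy
  rw [← Finset.sum_div, div_right_comm, hcomm]
  congr 1
  rw [Finset.sum_div]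
  refine Finset.sum_congr rfl fun x _ => ?_
  rw [Finset.sum_div]
  refine Finset.sum_congr rfl fun y _ => ?_
  by_cases h : Γ.graph.Adj x y
  · rw [← Finset.mul_sum, ← hsq x y h, ← sub_div, ← Finset.sum_sub_distrib, div_pow, mul_div_assoc]
  · simp [Γ.weight_eq_zero x y h]

/-! ### Resistance of annuli -/

lemma innerMu_nonneg (hp : Γ.CondP0) {f : V → ℝ} (hf : f.support.Finite) :
    0 ≤ Γ.innerMu (fun x => - Γ.laplacian f x) f := by
  rw [innerMu_eq_energy (U := f.support) (S := (finite_closure hp hf).toFinset) (by simp)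
    fun x hx => by simpa using hx]
  exact energy_nonneg _ _

lemma resistance_nonneg (hp : Γ.CondP0) (A B : Set V) : 0 ≤ Γ.resistance A B := by
  refine inv_nonneg.2 (Real.sInf_nonneg ?_)
  rintro e ⟨f, hf, -, -, rfl⟩
  exact innerMu_nonneg hp hf

lemma rhoV_nonneg (hconn : Γ.graph.Connected) (hp : Γ.CondP0) (x : V) {R : ℝ} (hR : 0 < R) :
    0 ≤ Γ.rhoV x R :=
  mul_nonneg (resistance_nonneg hp _ _) (annulusVolume_nonneg hconn hp x (by linarith))

/-- The infimum need not be attained, hence the strict bound on `e`. Positivity of the resistance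
rules out an empty set of test functions, for which `sInf` is `0` by convention. -/
lemma hasCutoff_of_inv_resistance_lt {A U : Set V} {S : Finset V} (hS : Γ.closure U ⊆ S) (hpos : 0 < Γ.resistance A Uᶜ) {e : ℝ}
    (he : (Γ.resistance A Uᶜ)⁻¹ < e) : Γ.HasCutoff S A U e := by
  unfold resistance at hpos he
  rw [inv_inv] at he
  have hne : {e : ℝ | ∃ f : V → ℝ, f.support.Finite ∧ (∀ x ∈ A, f x = 1) ∧
      (∀ x ∈ Uᶜ, f x = 0) ∧ e = Γ.innerMu (fun x => - Γ.laplacian f x) f}.Nonempty := by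
    by_contra h
    rw [Set.not_nonempty_iff_eq_empty.1 h, Real.sInf_empty, inv_zero] at hpos
    exact lt_irrefl _ hpos
  obtain ⟨_, ⟨f, -, hA, hB, rfl⟩, hf⟩ := exists_lt_of_csInf_lt hne he
  rw [innerMu_eq_energy hS hB] at hf
  refine ⟨fun x => max 0 (min 1 (f x)), fun x => ⟨le_max_left _ _,
    max_le zero_le_one (min_le_left _ _)⟩, fun x hx => by simp [hA x hx],
    fun x hx => by simp [hB x hx], (energy_clip_le S f).trans hf.le⟩

/-- A walk from `A` to a vertex off `U` bounds every admissible energy below. Without this the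
infimum could be `0`, whose inverse is `0` in Lean, and a small-energy cutoff would prove nothing.
-/
lemma inv_le_resistance (hconn : Γ.graph.Connected) {A U : Set V} {x z : V}
    (hx : x ∈ A) (hz : z ∉ U) (hU : U.Finite) {S : Finset V} (hS : Γ.closure U ⊆ S) {e : ℝ}
    (h : Γ.HasCutoff S A U e) : 0 < e ∧ e⁻¹ ≤ Γ.resistance A Uᶜ := by
  obtain ⟨p⟩ := hconn x z
  obtain ⟨K, hK, hKf⟩ := exists_sq_sub_le_energy p
  obtain ⟨g, -, g2, g3, g4⟩ := h
  set E := {e : ℝ | ∃ f : V → ℝ, f.support.Finite ∧ (∀ x ∈ A, f x = 1) ∧ (∀ x ∈ Uᶜ, f x = 0) ∧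
    e = Γ.innerMu (fun x => - Γ.laplacian f x) f} with hE
  have hgE : Γ.energy S g ∈ E := by
    refine ⟨g, hU.subset fun y hy => ?_, g2, g3, (innerMu_eq_energy hS g3).symm⟩
    by_contra hn
    exact hy (g3 y hn)
  have hlow : ∀ a ∈ E, K⁻¹ ≤ a := by
    rintro _ ⟨f, -, hA, hB, rfl⟩
    rw [innerMu_eq_energy hS hB]
    have := hKf U S f hS hB
    rw [hA x hx, hB z hz] at this
    rw [inv_le_iff_one_le_mul₀' hK]
    linarith
  have hpos : 0 < sInf E := lt_of_lt_of_le (inv_pos.2 hK) (le_csInf ⟨_, hgE⟩ hlow)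
  have hle : sInf E ≤ e := (csInf_le ⟨K⁻¹, hlow⟩ hgE).trans g4
  exact ⟨hpos.trans_le hle, inv_anti₀ hpos hle⟩

/-! ### Nets, gluing and averaging of cutoffs -/

/-- A maximal `R`-separated subset of a finite set is an `R`-net. -/
lemma exists_net {B : Set V} (hB : B.Finite) {R : ℝ} (hR : 0 < R) :
    ∃ Y : Finset V, ↑Y ⊆ B ∧ (∀ y ∈ Y, ∀ z ∈ Y, y ≠ z → R ≤ Γ.graph.dist y z) ∧
      B ⊆ ⋃ y ∈ Y, Γ.ball y R := by
  classical
  lift B to Finset V using hB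
  let Separated : Finset V → Prop := fun Y =>
    ∀ y ∈ Y, ∀ z ∈ Y, y ≠ z → R ≤ (Γ.graph.dist y z : ℝ)
  let P := B.powerset.filter Separated
  obtain ⟨Y, hY, hmax⟩ := P.exists_max_image Finset.card ⟨∅, by simp [P, Separated]⟩
  obtain ⟨hYB, hsep⟩ := Finset.mem_filter.1 hY
  rw [Finset.mem_powerset] at hYB
  refine ⟨Y, by exact_mod_cast hYB, hsep, fun x hx => ?_⟩
  by_contra hn
  have hfar : ∀ y ∈ Y, R ≤ (Γ.graph.dist y x : ℝ) := fun y hy => by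
    by_contra! h
    exact hn (Set.mem_biUnion (show y ∈ (Y : Set V) from hy) h)
  have hxY : x ∉ Y := fun h => by
    have := hfar x h
    simp only [SimpleGraph.dist_self, Nat.cast_zero] at this
    linarith
  have hins : insert x Y ∈ P := by
    refine Finset.mem_filter.2 ⟨Finset.mem_powerset.2 (Finset.insert_subset hx hYB), ?_⟩
    intro y hy z hz hyz
    rcases Finset.mem_insert.1 hy with hy' | hy' <;> rcases Finset.mem_insert.1 hz with hz' | hz'
    · exact absurd (hy'.trans hz'.symm) hyz
    · rw [hy', SimpleGraph.dist_comm]; exact hfar z hz'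
    · rw [hz']; exact hfar y hy'
    · exact hsep y hy' z hz' hyz
  have := hmax _ hins
  rw [Finset.card_insert_of_notMem hxY] at this
  omega

/-- Small-scale cutoffs glued along a net give a cutoff across a shell of width `2 * R`. -/
lemma hasCutoff_ball (hconn : Γ.graph.Connected) (hp : Γ.CondP0) {D : ℝ}
    (hD : 0 < D) (hVD : ∀ (x : V) (R : ℝ), 0 < R → Γ.volume x (2 * R) ≤ D * Γ.volume x R)
    {C F R : ℝ} (hC : 0 < C) (hF : 0 < F) (hR : 0 < R) (hrv : ∀ y, C⁻¹ * F ≤ Γ.rhoV y R)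
    (x : V) (r : ℝ) {S : Finset V} (hS : Γ.closure (Γ.ball x (r + 2 * R)) ⊆ S) :
    Γ.HasCutoff S (Γ.ball x r) (Γ.ball x (r + 2 * R))
      (2 * C * D ^ 2 / F * Γ.volume x (r + 2 * R)) := by
  obtain ⟨Y, hYB, hsep, hcov⟩ := exists_net (Γ := Γ) (finite_ball hconn hp x r) hR
  have hsub : ∀ y ∈ Y, Γ.ball y (2 * R) ⊆ Γ.ball x (r + 2 * R) := fun y hy =>
    ball_subset_ball hconn (by have : (Γ.graph.dist x y : ℝ) < r := hYB hy; linarith)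
  have hcut : ∀ y ∈ Y, Γ.HasCutoff S (Γ.ball y R) (Γ.ball y (2 * R))
      (2 * C * D ^ 2 / F * Γ.volume y (R / 2)) := by
    intro y hy
    have hv := annulusVolume_nonneg hconn hp y (show R ≤ 2 * R by linarith)
    have hρ := resistance_nonneg hp (Γ.ball y R) (Γ.ball y (2 * R))ᶜ
    have hprod : C⁻¹ * F ≤ Γ.resistance (Γ.ball y R) (Γ.ball y (2 * R))ᶜ *
      Γ.annulusVolume y R (2 * R) := hrv y
    have hpos : 0 < Γ.resistance (Γ.ball y R) (Γ.ball y (2 * R))ᶜ *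
      Γ.annulusVolume y R (2 * R) := lt_of_lt_of_le (by positivity) hprod
    have hρ' := pos_of_mul_pos_left hpos hv
    have hv' := pos_of_mul_pos_right hpos hρ
    -- Two doublings reach radius `R/2`, at which balls centred at an `R`-separated set are
    -- disjoint.
    have hle : Γ.annulusVolume y R (2 * R) ≤ D ^ 2 * Γ.volume y (R / 2) := by
      have a1 := hVD y R hR
      have a2 := hVD y (R / 2) (by linarith)
      rw [show 2 * (R / 2) = R by ring] at a2
      have a3 := setMeasure_nonneg (Γ := Γ) (Γ.ball y R)
      have a4 := mul_le_mul_of_nonneg_left a2 hD.le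
      unfold annulusVolume
      have a5 : 0 ≤ Γ.volume y R := a3
      nlinarith
    refine hasCutoff_of_inv_resistance_lt ?_ hρ' ?_
    · refine subset_trans ?_ hS
      rintro z (hz | ⟨w, hw, hwz⟩)
      · exact Or.inl (hsub y hy hz)
      · exact Or.inr ⟨w, hsub y hy hw, hwz⟩
    · calc (Γ.resistance (Γ.ball y R) (Γ.ball y (2 * R))ᶜ)⁻¹
          ≤ C / F * Γ.annulusVolume y R (2 * R) := by
            rw [inv_le_iff_one_le_mul₀' hρ']
            calc (1 : ℝ) = C / F * (C⁻¹ * F) := by field_simp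
              _ ≤ C / F * (_ * _) := mul_le_mul_of_nonneg_left hprod (by positivity)
              _ = _ := by ring
        -- The factor `2` only buys the strict inequality.
        _ < 2 * (C / F * Γ.annulusVolume y R (2 * R)) := by
            have : 0 < C / F * Γ.annulusVolume y R (2 * R) := by positivity
            linarith
        _ ≤ 2 * (C / F * (D ^ 2 * Γ.volume y (R / 2))) := by gcongr
        _ = _ := by ring
  refine (HasCutoff.biUnion Y hcut).mono hcov (Set.iUnion₂_subset hsub) ?_
  rw [← Finset.mul_sum]
  refine mul_le_mul_of_nonneg_left ?_ (by positivity)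
  refine sum_setMeasure_le Y (fun y => Γ.ball y (R / 2)) (finite_ball hconn hp _ _)
    (fun y hy => (ball_mono y (by linarith)).trans (hsub y hy)) fun y hy z hz hyz => ?_
  exact disjoint_ball hconn (by linarith [hsep y hy z hz hyz])

/-- Averaging `k` shell cutoffs gains a factor `k` in the energy. -/
lemma hasCutoff_average {x : V} (hconn : Γ.graph.Connected) {S : Finset V} {T R E : ℝ} {k : ℕ}
    (hk : 0 < k) (hR : 1 ≤ 2 * R) (hkT : 4 * R * k ≤ T)
    (hcut : ∀ i < k, Γ.HasCutoff S (Γ.ball x (T + 4 * R * i))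
      (Γ.ball x (T + 4 * R * i + 2 * R)) E) :
    Γ.HasCutoff S (Γ.ball x T) (Γ.ball x (2 * T)) (E / k) := by
  have hcut' : ∀ i, ∃ g : V → ℝ, i < k → ((∀ x, 0 ≤ g x ∧ g x ≤ 1) ∧
      (∀ y ∈ Γ.ball x (T + 4 * R * i), g y = 1) ∧
      (∀ y ∉ Γ.ball x (T + 4 * R * i + 2 * R), g y = 0) ∧ Γ.energy S g ≤ E) := fun i => by
    by_cases hi : i < k
    · obtain ⟨g, hg⟩ := hcut i hi
      exact ⟨g, fun _ => hg⟩
    · exact ⟨0, fun h => absurd h hi⟩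
  choose g' hg' using hcut'
  -- Zero beyond `k`, so that the edge condition of `energy_sum_div` holds for all pairs of indices.
  let g : ℕ → V → ℝ := fun i => if i < k then g' i else 0
  have hg : ∀ i < k, g i = g' i := fun i hi => if_pos hi
  have hk' : (0 : ℝ) < k := by exact_mod_cast hk
  -- An edge meeting the `i`-th outer ball lies within one more unit of `x`; as `1 ≤ 2R`, it stays
  -- in the ball where every later cutoff equals `1`.
  have step : ∀ i j, i < j → j < k → ∀ a b, Γ.graph.Adj a b → a ∈ Γ.ball x (T + 4 * R * i + 2 * R) →
      g' j a = 1 ∧ g' j b = 1 := by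
    intro i j hij hj a b hab ha
    have ha' : (Γ.graph.dist x a : ℝ) < T + 4 * R * i + 2 * R := ha
    have h1 := dist_triangle_real hconn x a b
    rw [SimpleGraph.dist_eq_one_iff_adj.2 hab, Nat.cast_one] at h1
    have hij' : (i : ℝ) + 1 ≤ j := by exact_mod_cast hij
    have h2 : 4 * R * (i + 1) ≤ 4 * R * j := mul_le_mul_of_nonneg_left hij' (by linarith)
    refine ⟨(hg' j hj).2.1 a ?_, (hg' j hj).2.1 b ?_⟩
    · show (Γ.graph.dist x a : ℝ) < _; linarith
    · show (Γ.graph.dist x b : ℝ) < _; linarith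
  have const : ∀ i j, i < j → j < k → ∀ a b, Γ.graph.Adj a b →
      g' i a = g' i b ∨ g' j a = g' j b := by
    intro i j hij hj a b hab
    by_cases ha : a ∈ Γ.ball x (T + 4 * R * i + 2 * R)
    · obtain ⟨h1, h2⟩ := step i j hij hj a b hab ha
      exact Or.inr (h1.trans h2.symm)
    by_cases hb : b ∈ Γ.ball x (T + 4 * R * i + 2 * R)
    · obtain ⟨h1, h2⟩ := step i j hij hj b a hab.symm hb
      exact Or.inr (h2.trans h1.symm)
    · have h0 := (hg' i (hij.trans hj)).2.2.1
      exact Or.inl ((h0 a ha).trans (h0 b hb).symm)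
  have hsum : ∀ (c : ℝ) (y : V), (∀ i < k, g' i y = c) →
      (∑ i ∈ Finset.range k, g i y) / k = c := fun c y h => by
    rw [Finset.sum_congr rfl fun i hi => by
      rw [hg i (Finset.mem_range.1 hi), h i (Finset.mem_range.1 hi)]]
    rw [Finset.sum_const, Finset.card_range, nsmul_eq_mul]
    field_simp
  have hgb : ∀ i ∈ Finset.range k, ∀ y, 0 ≤ g i y ∧ g i y ≤ 1 := fun i hi => by
    rw [hg i (Finset.mem_range.1 hi)]
    exact (hg' i (Finset.mem_range.1 hi)).1
  refine ⟨fun y => (∑ i ∈ Finset.range k, g i y) / k, fun y => ⟨?_, ?_⟩, fun y hy => ?_,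
    fun y hy => ?_, ?_⟩
  · exact div_nonneg (Finset.sum_nonneg fun i hi => (hgb i hi y).1) hk'.le
  · rw [div_le_one hk']
    refine (Finset.sum_le_sum fun i hi => (hgb i hi y).2).trans ?_
    simp
  · refine hsum 1 y fun i hi => (hg' i hi).2.1 y (ball_mono x ?_ hy)
    have : 0 ≤ 4 * R * i := mul_nonneg (by linarith) (Nat.cast_nonneg i)
    linarith
  · refine hsum 0 y fun i hi => (hg' i hi).2.2.1 y fun h => hy (ball_mono x ?_ h)
    have hi' : (i : ℝ) + 1 ≤ k := by exact_mod_cast hi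
    have h2 : 4 * R * (i + 1) ≤ 4 * R * k := mul_le_mul_of_nonneg_left hi' (by linarith)
    linarith
  · rw [energy_sum_div]
    · calc (∑ i ∈ Finset.range k, Γ.energy S (g i)) / (k : ℝ) ^ 2
          ≤ (∑ i ∈ Finset.range k, E) / (k : ℝ) ^ 2 := by
            gcongr with i hi
            rw [hg i (Finset.mem_range.1 hi)]
            exact (hg' i (Finset.mem_range.1 hi)).2.2.2
        _ = E / k := by
            rw [Finset.sum_const, Finset.card_range, nsmul_eq_mul]
            field_simp
    · intro i j hij a b hab hne
      by_cases hi : i < k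
      · by_cases hj : j < k
        · rw [hg i hi] at hne
          rw [hg j hj]
          rcases lt_or_gt_of_ne hij with h | h
          · exact (const i j h hj a b hab).resolve_left hne
          · exact (const j i h hi a b hab).resolve_right hne
        · simp [g, hj]
      · simp [g, hi] at hne

/-! ### Choice of scale and conclusion -/

lemma rhoV_eq_zero_of_le_half (hconn : Γ.graph.Connected) (x : V) {R : ℝ} (h0 : 0 < R)
    (hR : 2 * R ≤ 1) : Γ.rhoV x R = 0 := by
  unfold rhoV annulusVolume volume
  rw [ball_eq_singleton hconn x h0 (by linarith), ball_eq_singleton hconn x (by linarith) hR,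
    sub_self, mul_zero]

lemma exists_two_mul_rhoV_le [Infinite V] (hconn : Γ.graph.Connected) (hp : Γ.CondP0)
    (hVD : Γ.VolumeDoubling) (hrv : Γ.CondRhoV) :
    ∃ A : ℝ, 1 < A ∧ ∀ (x : V) (R : ℝ), 0 < R → 2 * Γ.rhoV x R ≤ Γ.rhoV x (A * R) := by
  obtain ⟨D, hD, hVD⟩ := hVD
  obtain ⟨C, hC, hrv⟩ := hrv
  have hC0 : 0 < C := by linarith
  -- In `4CD⁶`, `2CD²` is the shell energy constant, `D⁴` compares ball and annulus, and `2` is the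
  -- gain sought. With `k > 2` and `2R > 1` one also gets `T ≥ 4`.
  obtain ⟨k, hk⟩ := exists_nat_gt (max 2 (4 * C * D ^ 6))
  have hk2 : (2 : ℝ) < k := (le_max_left _ _).trans_lt hk
  have hkC : 4 * C * D ^ 6 < k := (le_max_right _ _).trans_lt hk
  refine ⟨4 * k, by linarith, fun x R hR => ?_⟩
  have hAR : 0 < 4 * (k : ℝ) * R := by positivity
  have hnn := rhoV_nonneg hconn hp x hAR
  rcases (rhoV_nonneg hconn hp x hR).eq_or_lt with hF | hF
  · rwa [← hF, mul_zero]
  -- At smaller scales the annulus is empty and `F` vanishes, a case already settled.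
  have hR2 : 1 < 2 * R := by
    by_contra! h
    exact hF.ne' (rhoV_eq_zero_of_le_half hconn x hR h)
  set F := Γ.rhoV x R with hFdef
  set T := 4 * (k : ℝ) * R with hT
  have hT4 : 4 ≤ T := by nlinarith
  have hfin := finite_ball hconn hp x (2 * T)
  have hSfin := finite_closure hp hfin
  have hS : Γ.closure (Γ.ball x (2 * T)) ⊆ hSfin.toFinset := by simp
  set M := 2 * C * D ^ 2 / F * Γ.volume x (2 * T) with hM
  have hcut : Γ.HasCutoff hSfin.toFinset (Γ.ball x T) (Γ.ball x (2 * T)) (M / k) := by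
    refine hasCutoff_average hconn (by exact_mod_cast (by linarith : (0 : ℝ) < k)) hR2.le
      (by rw [hT]; linarith) fun i hi => ?_
    have hle : T + 4 * R * i + 2 * R ≤ 2 * T := by
      have hi' : (i : ℝ) + 1 ≤ k := by exact_mod_cast hi
      have h2 : 4 * R * (i + 1) ≤ 4 * R * k := mul_le_mul_of_nonneg_left hi' (by linarith)
      linarith
    refine (hasCutoff_ball hconn hp hD hVD hC0 hF hR (fun y => (hrv x y R hR).1) x
      (T + 4 * R * i) ?_).mono subset_rfl subset_rfl ?_
    · refine subset_trans ?_ hS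
      rintro z (hz | ⟨w, hw, hwz⟩)
      · exact Or.inl (ball_mono x hle hz)
      · exact Or.inr ⟨w, ball_mono x hle hw, hwz⟩
    · exact mul_le_mul_of_nonneg_left (volume_mono hconn hp x hle) (by positivity)
  obtain ⟨z, hz⟩ := hfin.exists_notMem
  obtain ⟨hpos, hres⟩ := inv_le_resistance hconn (mem_ball_self x hAR) hz hfin hS hcut
  have hv := annulusVolume_nonneg hconn hp x (show T ≤ 2 * T by linarith)
  have hvol := volume_le_annulusVolume hconn hp hD hVD x hT4
  have hk0 : (0 : ℝ) < k := by linarith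
  have hbound : 2 * F * (M / k) ≤ Γ.annulusVolume x T (2 * T) := by
    calc 2 * F * (M / k) = 4 * C * D ^ 2 / k * Γ.volume x (2 * T) := by
          rw [hM]; field_simp; ring
      _ ≤ 4 * C * D ^ 2 / k * (D ^ 4 * Γ.annulusVolume x T (2 * T)) := by gcongr
      _ = 4 * C * D ^ 6 / k * Γ.annulusVolume x T (2 * T) := by ring
      _ ≤ 1 * Γ.annulusVolume x T (2 * T) := by
          gcongr
          rw [div_le_one hk0]
          exact hkC.le
      _ = _ := one_mul _
  calc 2 * F ≤ (M / k)⁻¹ * Γ.annulusVolume x T (2 * T) := by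
        rw [← div_eq_inv_mul, le_div_iff₀ hpos]
        exact hbound
    _ ≤ Γ.rhoV x T := mul_le_mul_of_nonneg_right hres hv

end

end WeightedGraph

theorem mainTheorem8 {V : Type*} [Countable V] [Infinite V] (Γ : WeightedGraph V)
    (hconn : Γ.graph.Connected) (hp0 : Γ.CondP0) (hVD : Γ.VolumeDoubling)
    (hH : Γ.EllipticHarnack) (hrv : Γ.CondRhoV) :
    ∃ A : ℝ, 1 < A ∧ ∀ (x : V) (R : ℝ), 0 < R →
      2 * (Γ.annulusResistance x R (2 * R) * Γ.annulusVolume x R (2 * R)) ≤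
        Γ.annulusResistance x (A * R) (2 * (A * R)) *
          Γ.annulusVolume x (A * R) (2 * (A * R)) :=
  WeightedGraph.exists_two_mul_rhoV_le hconn hp0 hVD hrv
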